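/- Let $\mathcal H$ be the set of positive constant functions $s:(0,\infty)\to(0,\infty)$, let $\mathcal P$ be the set of asymptotically subpower functions, i.e. of all (not necessarily continuous) $s:(0,\infty)\to(0,\infty)$ such that for every $a>0$ there is $t_0>0$ with $s(t)<t^{a}$ for all $t>t_0$, and let $\mathcal L$ be the set of asymptotically sublinear functions, defined in the same way with $s(t)<a\,t$ in place of $s(t)<t^{a}$. Let $X=[0,\infty)$ carry the usual metric $d(x,y)=|x-y|$, with base point $0$, and write $B(x,r)$ for the ball with centre $x$ and radius $r$. For $A\in\{H,P,L\}$ let $C_A(X)$ be the set of all bounded continuous functions $f:X\to\mathbb R$ such that $\lim_{x\to\infty}\operatorname{diam} f(B(x,s(x)))=0$ for every $s\in\mathcal H$, $s\in\mathcal P$, $s\in\mathcal L$ respectively. Let $h_A(X)$ be the closure of the image of the evaluation map $e_A:X\to\prod_{f\in C_A(X)}[\inf f,\sup f]$, $e_A(x)=(f(x))_f$, in the product topology. Identify $X$ with $e_A(X)$, and put $\nu_A X=h_A(X)\setminus X$. Thus $h_H(X)$, $h_P(X)$, $h_L(X)$ are the Higson, the subpower Higson and the sublinear Higson compactification of $X$,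 and $\nu_H X$, $\nu_P X$, $\nu_L X$ are their coronas. Then there is a unique continuous map $\alpha:h_H(X)\to h_P(X)$ that restricts to the identity on $X$; it satisfies $\alpha(\nu_H X)=\nu_P X$. For each $A\in\{H,P,L\}$ there is a continuous surjection $\eta_A:\nu_H X\to h_A(X)$ from the Higson corona onto $h_A(X)$; moreover $\eta_A$ can be chosen of the form $\eta_A=\xi_A\circ\alpha|_{\nu_H X}$, where $\xi_A:\nu_P X\to h_A(X)$ is a continuous surjection. -/

import Mathlib

/-- The three labels `H` (Higson), `P` (subpower Higson), `L` (sublinear Higson). -/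
inductive HigsonKind : Type
  | H
  | P
  | L

/-- `s` is a (not necessarily continuous) function from the positive reals to the positive reals.
Functions on the positive reals are represented by functions `ℝ → ℝ`, whose values at
nonpositive arguments are irrelevant. -/
def IsPositiveOnPositive (s : ℝ → ℝ) : Prop :=
  ∀ t : ℝ, 0 < t → 0 < s t

/-- `s : ℝ₊ → ℝ₊` is asymptotically subpower: for every `a > 0`, eventually `s t < t ^ a`. -/
def IsAsymptoticallySubpower (s : ℝ → ℝ) : Prop :=
  IsPositiveOnPositive s ∧ ∀ a : ℝ, 0 < a → ∃ t₀ : ℝ, 0 < t₀ ∧ ∀ t : ℝ, t₀ < t → s t < t ^ a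

/-- `s : ℝ₊ → ℝ₊` is asymptotically sublinear: for every `a > 0`, eventually `s t < a * t`. -/
def IsAsymptoticallySublinear (s : ℝ → ℝ) : Prop :=
  IsPositiveOnPositive s ∧ ∀ a : ℝ, 0 < a → ∃ t₀ : ℝ, 0 < t₀ ∧ ∀ t : ℝ, t₀ < t → s t < a * t

/-- `s : ℝ₊ → ℝ₊` is a positive constant function. -/
def IsPositiveConstant (s : ℝ → ℝ) : Prop :=
  ∃ c : ℝ, 0 < c ∧ ∀ t : ℝ, 0 < t → s t = c

/-- The class of scale functions attached to each label: positive constants for `H`,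
asymptotically subpower functions for `P`, asymptotically sublinear functions for `L`. -/
def HigsonKind.scales : HigsonKind → Set (ℝ → ℝ)
  | .H => {s | IsPositiveConstant s}
  | .P => {s | IsAsymptoticallySubpower s}
  | .L => {s | IsAsymptoticallySublinear s}

/-- The vanishing condition `lim_{|x| → ∞} diam f (B (x, s |x|)) = 0`, where `|x| = d (x₀, x)`. -/
def VanishingVariation {X Y : Type*} [MetricSpace X] [MetricSpace Y] (x₀ : X) (s : ℝ → ℝ)
    (f : X → Y) : Prop :=
  Filter.Tendsto (fun x : X => Metric.ediam (f '' Metric.ball x (s (dist x₀ x))))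
    (Filter.comap (fun x : X => dist x₀ x) Filter.atTop) (nhds 0)

/-- `C_A (X)`: the bounded continuous real functions on `X` that satisfy the vanishing condition
for every scale function of kind `A`. -/
def higsonFunctions {X : Type*} [MetricSpace X] (A : HigsonKind) (x₀ : X) :
    Set (BoundedContinuousFunction X ℝ) :=
  {f | ∀ s ∈ A.scales, VanishingVariation x₀ s f}

/-- The cube `∏_{f ∈ C_A (X)} I_f` with `I_f = [inf f, sup f]`, with the product topology. -/
abbrev HigsonCube {X : Type*} [MetricSpace X] (A : HigsonKind) (x₀ : X) : Type _ :=
  (f : higsonFunctions A x₀) →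
    Set.Icc (⨅ x : X, (f : BoundedContinuousFunction X ℝ) x)
      (⨆ x : X, (f : BoundedContinuousFunction X ℝ) x)

theorem boundedContinuousFunction_mem_Icc {X : Type*} [MetricSpace X]
    (f : BoundedContinuousFunction X ℝ) (x : X) : f x ∈ Set.Icc (⨅ y : X, f y) (⨆ y : X, f y) :=
  ⟨ciInf_le f.isBounded_range.bddBelow x, le_ciSup f.isBounded_range.bddAbove x⟩

/-- The evaluation map `X → ∏_{f ∈ C_A (X)} I_f`. -/
def higsonEval {X : Type*} [MetricSpace X] (A : HigsonKind) (x₀ : X) (x : X) : HigsonCube A x₀ :=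
  fun f => ⟨(f : BoundedContinuousFunction X ℝ) x, boundedContinuousFunction_mem_Icc _ x⟩

/-- The Higson type compactification `h_A (X)`: the closure of the image of the evaluation map,
with the subspace topology. -/
abbrev HigsonCompactification {X : Type*} [MetricSpace X] (A : HigsonKind) (x₀ : X) : Type _ :=
  closure (Set.range (higsonEval A x₀))

/-- The canonical map `X → h_A (X)`, by which `X` is identified with a subspace of `h_A (X)`. -/
def higsonIncl {X : Type*} [MetricSpace X] (A : HigsonKind) (x₀ : X) (x : X) :
    HigsonCompactification A x₀ :=
  ⟨higsonEval A x₀ x, subset_closure (Set.mem_range_self x)⟩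

/-- The corona `ν_A X = h_A (X) \ X`. -/
def higsonCorona {X : Type*} [MetricSpace X] (A : HigsonKind) (x₀ : X) :
    Set (HigsonCompactification A x₀) :=
  (Set.range (higsonIncl A x₀))ᶜ

/-- `α : h_A (X) → h_B (X)` is a continuous map that restricts to the identity of `X`. -/
def IsCanonicalHigsonMap {X : Type*} [MetricSpace X] (A B : HigsonKind) (x₀ : X)
    (α : HigsonCompactification A x₀ → HigsonCompactification B x₀) : Prop :=
  Continuous α ∧ ∀ x : X, α (higsonIncl A x₀ x) = higsonIncl B x₀ x

/-!
The maps below are all built from pullbacks: a continuous `g : X → Y` such that `f ∘ g` lies in `C_A(X)`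
whenever `f` lies in `C_B(Y)` induces a continuous map `h_A(X) → h_B(Y)` extending `g`
(`higsonMap`). Constant functions are subpower and subpower functions are sublinear, so
`C_L ⊆ C_P ⊆ C_H`, and the identity induces canonical surjections from `h_H(X)` onto each `h_A(X)`.

In a proper space the truncated distances `max 0 (r - d(x₀, x))` belong to every `C_A(X)`, and a
point of `h_A(X)` belongs to the corona exactly when all of them vanish at it
(`mem_higsonCorona_iff`). Hence coronas are closed, and canonical maps send corona onto corona.

The surjection from the corona of `[0, ∞)` comes from the slowly oscillating function
`g(x) = |v sin v|` with `v = log (1 + log (1 + x))`. It takes every value of `[0, ∞)` at arbitrarily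
large arguments, and its variation over balls of sublinear radius tends to zero. Functions in
`C_H(X)` are uniformly continuous, so `f ∘ g ∈ C_A(X)` for all `f ∈ C_H(X)`, and `g` extends to a
continuous map `h_A(X) → h_H(X)`. The image of the corona under this extension is compact and
contains the dense set `X`: a value `y = g(xₙ)` with `xₙ → ∞` is also the value at any cluster point
of `(xₙ)`. So the corona already maps onto `h_H(X)`, and from there onto every `h_A(X)`.
-/

open Filter Topology

/-! ### Scale functions -/

theorem IsAsymptoticallySubpower.isAsymptoticallySublinear {s : ℝ → ℝ}
    (hs : IsAsymptoticallySubpower s) : IsAsymptoticallySublinear s := by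
  refine ⟨hs.1, fun a ha => ?_⟩
  obtain ⟨t₀, ht₀, h⟩ := hs.2 (1 / 2) (by norm_num)
  refine ⟨max t₀ (a⁻¹ ^ 2), lt_max_of_lt_left ht₀, fun t ht => ?_⟩
  have h1 : t₀ < t := (le_max_left _ _).trans_lt ht
  have h2 : a⁻¹ ^ 2 < t := (le_max_right _ _).trans_lt ht
  have htpos : 0 < t := ht₀.trans h1
  refine (h t h1).trans_le ?_
  rw [← Real.sqrt_eq_rpow]
  have h3 : a⁻¹ ≤ √t := Real.le_sqrt_of_sq_le h2.le
  have h4 : 1 ≤ a * √t := by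
    have := mul_le_mul_of_nonneg_left h3 ha.le
    rwa [mul_inv_cancel₀ ha.ne'] at this
  calc √t = 1 * √t := (one_mul _).symm
    _ ≤ a * √t * √t := mul_le_mul_of_nonneg_right h4 (Real.sqrt_nonneg t)
    _ = a * t := by rw [mul_assoc, Real.mul_self_sqrt htpos.le]

theorem IsPositiveConstant.isAsymptoticallySubpower {s : ℝ → ℝ}
    (hs : IsPositiveConstant s) : IsAsymptoticallySubpower s := by
  obtain ⟨c, hc, h⟩ := hs
  refine ⟨fun t ht => (h t ht).symm ▸ hc, fun a ha => ?_⟩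
  obtain ⟨t₀, ht₀⟩ := eventually_atTop.1 ((tendsto_rpow_atTop ha).eventually_gt_atTop c)
  refine ⟨max t₀ 1, by positivity, fun t ht => ?_⟩
  have h0 : 0 < t := one_pos.trans ((le_max_right _ _).trans_lt ht)
  rw [h t h0]
  exact ht₀ t ((le_max_left _ _).trans ht.le)

theorem HigsonKind.H_scales_subset (A : HigsonKind) : HigsonKind.H.scales ⊆ A.scales := by
  intro s hs
  have hP := IsPositiveConstant.isAsymptoticallySubpower hs
  cases A
  · exact hs
  · exact hP
  · exact hP.isAsymptoticallySublinear

theorem HigsonKind.isAsymptoticallySublinear_of_mem_scales {A : HigsonKind} {s : ℝ → ℝ}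
    (hs : s ∈ A.scales) : IsAsymptoticallySublinear s := by
  cases A
  · exact (IsPositiveConstant.isAsymptoticallySubpower hs).isAsymptoticallySublinear
  · exact IsAsymptoticallySubpower.isAsymptoticallySublinear hs
  · exact hs

theorem IsAsymptoticallySublinear.eventually_lt_mul_dist {X : Type*} [MetricSpace X] (x₀ : X)
    {s : ℝ → ℝ} (hs : IsAsymptoticallySublinear s) {a : ℝ} (ha : 0 < a) :
    ∀ᶠ x in comap (fun x : X => dist x₀ x) atTop, s (dist x₀ x) < a * dist x₀ x := by
  obtain ⟨t₀, -, h⟩ := hs.2 a ha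
  exact ((eventually_gt_atTop t₀).comap _).mono fun x hx => h _ hx

/-! ### Functions of vanishing variation -/

section Functions

variable {X Y : Type*} [MetricSpace X] [MetricSpace Y]

theorem higsonFunctions_subset_H (A : HigsonKind) (x₀ : X) :
    higsonFunctions A x₀ ⊆ higsonFunctions HigsonKind.H x₀ :=
  fun _ hf s hs => hf s (A.H_scales_subset hs)

/-- In a proper space, continuity controls a function on a large ball, and vanishing variation over
unit balls controls it outside. -/
theorem uniformContinuous_of_mem_higsonFunctions_H [ProperSpace X] {x₀ : X}
    {f : BoundedContinuousFunction X ℝ} (hf : f ∈ higsonFunctions HigsonKind.H x₀) :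
    UniformContinuous f := by
  rw [EMetric.uniformContinuous_iff]
  intro ε hε
  have h1 : VanishingVariation x₀ (fun _ => (1 : ℝ)) f := hf _ ⟨1, one_pos, fun _ _ => rfl⟩
  obtain ⟨R, hR⟩ := eventually_atTop.1 (eventually_comap.1 (h1.eventually_lt_const hε))
  have hK := (isCompact_closedBall x₀ R).uniformContinuousAt_of_continuousAt f
    (fun x _ => f.continuous.continuousAt) (edist_mem_uniformity hε)
  obtain ⟨δ, hδ, hδK⟩ := mem_uniformity_edist.1 hK
  refine ⟨min δ 1, lt_min hδ one_pos, fun {x y} hxy => ?_⟩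
  by_cases hx : x ∈ Metric.closedBall x₀ R
  · exact hδK (hxy.trans_le (min_le_left _ _)) hx
  · have hx' : R ≤ dist x₀ x := by
      rw [Metric.mem_closedBall, not_le, dist_comm] at hx
      exact hx.le
    refine (Metric.edist_le_ediam_of_mem (Set.mem_image_of_mem f ?_)
      (Set.mem_image_of_mem f ?_)).trans_lt (hR _ hx' x rfl)
    · exact Metric.mem_ball_self one_pos
    · rw [Metric.mem_ball, dist_comm, ← edist_lt_ofReal, ENNReal.ofReal_one]
      exact hxy.trans_le (min_le_right _ _)

theorem VanishingVariation.comp_uniformContinuous {Z : Type*} [MetricSpace Z] {x₀ : X} {s : ℝ → ℝ}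
    {g : X → Y} {f : Y → Z} (hg : VanishingVariation x₀ s g) (hf : UniformContinuous f) :
    VanishingVariation x₀ s (f ∘ g) := by
  rw [VanishingVariation, ENNReal.tendsto_nhds_zero]
  intro ε hε
  obtain ⟨δ, hδ, hfδ⟩ := EMetric.uniformContinuous_iff.1 hf ε hε
  filter_upwards [hg.eventually_lt_const hδ] with x hx
  refine Metric.ediam_le ?_
  rintro _ ⟨a, ha, rfl⟩ _ ⟨b, hb, rfl⟩
  exact (hfδ ((Metric.edist_le_ediam_of_mem (Set.mem_image_of_mem g ha)
    (Set.mem_image_of_mem g hb)).trans_lt hx)).le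

/-- The truncated distance `x ↦ max 0 (r - d(x₀, x))`, supported in the closed ball of radius `r`. -/
noncomputable def truncatedDist (x₀ : X) (r : ℝ) : BoundedContinuousFunction X ℝ :=
  BoundedContinuousFunction.ofNormedAddCommGroup (fun x => max 0 (r - dist x₀ x)) (by fun_prop) |r|
    fun x => by
      rw [Real.norm_of_nonneg (le_max_left _ _)]
      exact max_le (abs_nonneg r)
        ((sub_le_self r dist_nonneg).trans (le_abs_self r))

theorem truncatedDist_mem_higsonFunctions (A : HigsonKind) (x₀ : X) (r : ℝ) :
    truncatedDist x₀ r ∈ higsonFunctions A x₀ := by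
  intro s hs
  refine tendsto_const_nhds.congr' ?_
  filter_upwards [(HigsonKind.isAsymptoticallySublinear_of_mem_scales hs).eventually_lt_mul_dist
    x₀ (a := 1 / 2) (by norm_num), (eventually_gt_atTop (2 * r)).comap _] with x hx hxr
  symm
  -- Balls of radius `d(x₀, x) / 2` around far away points miss the support.
  have hzero : ∀ y ∈ Metric.ball x (s (dist x₀ x)), truncatedDist x₀ r y = 0 := by
    intro y hy
    rw [Metric.mem_ball] at hy
    have := dist_triangle x₀ y x
    exact max_eq_left (by linarith)
  refine Metric.ediam_subsingleton ?_
  rintro _ ⟨a, ha, rfl⟩ _ ⟨b, hb, rfl⟩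
  rw [hzero a ha, hzero b hb]

end Functions

/-! ### Higson compactifications and their coronas -/

section Compactification

variable {X Y : Type*} [MetricSpace X] [MetricSpace Y]

instance higsonCompactification_compactSpace (A : HigsonKind) (x₀ : X) :
    CompactSpace (HigsonCompactification A x₀) :=
  isCompact_iff_compactSpace.1 isClosed_closure.isCompact

theorem continuous_higsonIncl (A : HigsonKind) (x₀ : X) : Continuous (higsonIncl A x₀) :=
  (continuous_pi fun f => f.1.continuous.subtype_mk _).subtype_mk _

theorem denseRange_higsonIncl (A : HigsonKind) (x₀ : X) : DenseRange (higsonIncl A x₀) := by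
  intro q
  rw [closure_subtype, ← Set.range_comp]
  exact q.2

/-- The continuous extension to `h_A(X)` of a function of the class `C_A(X)`. -/
def higsonExtend (A : HigsonKind) (x₀ : X) (f : higsonFunctions A x₀)
    (q : HigsonCompactification A x₀) : ℝ :=
  (q : HigsonCube A x₀) f

theorem continuous_higsonExtend (A : HigsonKind) (x₀ : X) (f : higsonFunctions A x₀) :
    Continuous (higsonExtend A x₀ f) :=
  continuous_subtype_val.comp ((continuous_apply f).comp continuous_subtype_val)

section Map

/-- The map of cubes whose coordinate `f` is the coordinate `f ∘ g` of the argument, for a continuous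
map `g` such that `f ∘ g` is of class `C_A` whenever `f` is of class `C_B`. -/
def higsonCubeMap (A B : HigsonKind) (x₀ : X) (y₀ : Y) (g : C(X, Y))
    (hg : ∀ f ∈ higsonFunctions B y₀, f.compContinuous g ∈ higsonFunctions A x₀)
    (p : HigsonCube A x₀) : HigsonCube B y₀ :=
  have : Nonempty X := ⟨x₀⟩
  fun f =>
    let c := p ⟨f.1.compContinuous g, hg f.1 f.2⟩
    ⟨c, (le_ciInf fun x => (boundedContinuousFunction_mem_Icc f.1 (g x)).1).trans c.2.1,
      c.2.2.trans (ciSup_le fun x => (boundedContinuousFunction_mem_Icc f.1 (g x)).2)⟩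

theorem continuous_higsonCubeMap (A B : HigsonKind) (x₀ : X) (y₀ : Y) (g : C(X, Y))
    (hg : ∀ f ∈ higsonFunctions B y₀, f.compContinuous g ∈ higsonFunctions A x₀) :
    Continuous (higsonCubeMap A B x₀ y₀ g hg) :=
  continuous_pi fun f => Continuous.subtype_mk
    (continuous_subtype_val.comp (continuous_apply (⟨_, hg f.1 f.2⟩ : higsonFunctions A x₀))) _

theorem higsonCubeMap_eval (A B : HigsonKind) (x₀ : X) (y₀ : Y) (g : C(X, Y))
    (hg : ∀ f ∈ higsonFunctions B y₀, f.compContinuous g ∈ higsonFunctions A x₀) (x : X) :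
    higsonCubeMap A B x₀ y₀ g hg (higsonEval A x₀ x) = higsonEval B y₀ (g x) := rfl

/-- The continuous map of compactifications extending `g`. -/
def higsonMap (A B : HigsonKind) (x₀ : X) (y₀ : Y) (g : C(X, Y))
    (hg : ∀ f ∈ higsonFunctions B y₀, f.compContinuous g ∈ higsonFunctions A x₀)
    (q : HigsonCompactification A x₀) : HigsonCompactification B y₀ :=
  ⟨higsonCubeMap A B x₀ y₀ g hg q, map_mem_closure (continuous_higsonCubeMap A B x₀ y₀ g hg) q.2 (by
    rintro _ ⟨x, rfl⟩
    exact ⟨g x, (higsonCubeMap_eval A B x₀ y₀ g hg x).symm⟩)⟩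

variable {A B : HigsonKind} {x₀ : X} {y₀ : Y} {g : C(X, Y)}
  (hg : ∀ f ∈ higsonFunctions B y₀, f.compContinuous g ∈ higsonFunctions A x₀)

theorem continuous_higsonMap : Continuous (higsonMap A B x₀ y₀ g hg) :=
  ((continuous_higsonCubeMap A B x₀ y₀ g hg).comp continuous_subtype_val).subtype_mk _

theorem higsonMap_incl (x : X) :
    higsonMap A B x₀ y₀ g hg (higsonIncl A x₀ x) = higsonIncl B y₀ (g x) :=
  Subtype.ext (higsonCubeMap_eval A B x₀ y₀ g hg x)

end Map

theorem exists_isCanonicalHigsonMap_H (A : HigsonKind) (x₀ : X) :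
    ∃ α, IsCanonicalHigsonMap HigsonKind.H A x₀ α :=
  ⟨higsonMap HigsonKind.H A x₀ x₀ (ContinuousMap.id X)
    fun _ hf => higsonFunctions_subset_H A x₀ hf, continuous_higsonMap _, higsonMap_incl _⟩

theorem IsCanonicalHigsonMap.unique {A B : HigsonKind} {x₀ : X}
    {α β : HigsonCompactification A x₀ → HigsonCompactification B x₀}
    (hα : IsCanonicalHigsonMap A B x₀ α) (hβ : IsCanonicalHigsonMap A B x₀ β) : α = β :=
  (denseRange_higsonIncl A x₀).equalizer hα.1 hβ.1 <| funext fun x => (hα.2 x).trans (hβ.2 x).symm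

theorem IsCompact.image_eq_univ_of_higsonIncl_mem {Z : Type*} [TopologicalSpace Z] {K : Set Z}
    (hK : IsCompact K) {B : HigsonKind} {y₀ : Y} {φ : Z → HigsonCompactification B y₀}
    (hφ : Continuous φ) (h : ∀ y, higsonIncl B y₀ y ∈ φ '' K) : φ '' K = Set.univ := by
  rw [← (hK.image hφ).isClosed.closure_eq]
  exact ((denseRange_higsonIncl B y₀).mono (Set.range_subset_iff.2 h)).closure_eq

theorem IsCanonicalHigsonMap.surjective {A B : HigsonKind} {x₀ : X}
    {α : HigsonCompactification A x₀ → HigsonCompactification B x₀}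
    (hα : IsCanonicalHigsonMap A B x₀ α) : Function.Surjective α := by
  rw [← Set.range_eq_univ, ← Set.image_univ]
  exact isCompact_univ.image_eq_univ_of_higsonIncl_mem hα.1
    fun x => ⟨_, Set.mem_univ _, hα.2 x⟩

/-- The continuous extension of the truncated distance of radius `r` to `h_A(X)`. -/
noncomputable def truncatedDistExtend (A : HigsonKind) (x₀ : X) (r : ℝ) :
    HigsonCompactification A x₀ → ℝ :=
  higsonExtend A x₀ ⟨truncatedDist x₀ r, truncatedDist_mem_higsonFunctions A x₀ r⟩

theorem continuous_truncatedDistExtend (A : HigsonKind) (x₀ : X) (r : ℝ) :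
    Continuous (truncatedDistExtend A x₀ r) :=
  continuous_higsonExtend A x₀ _

theorem truncatedDistExtend_incl (A : HigsonKind) (x₀ x : X) (r : ℝ) :
    truncatedDistExtend A x₀ r (higsonIncl A x₀ x) = max 0 (r - dist x₀ x) := rfl

/-- A point where some truncated distance is positive is a limit of points of a compact ball of `X`,
so it lies in that ball. -/
theorem mem_higsonCorona_iff [ProperSpace X] {A : HigsonKind} {x₀ : X}
    {q : HigsonCompactification A x₀} :
    q ∈ higsonCorona A x₀ ↔ ∀ r, truncatedDistExtend A x₀ r q ≤ 0 := by
  constructor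
  · intro hq r
    by_contra! hpos
    apply hq
    have hK : IsClosed (higsonIncl A x₀ '' Metric.closedBall x₀ r) :=
      ((isCompact_closedBall x₀ r).image (continuous_higsonIncl A x₀)).isClosed
    refine Set.image_subset_range _ (Metric.closedBall x₀ r) (hK.closure_subset ?_)
    have hopen : IsOpen {p | 0 < truncatedDistExtend A x₀ r p} :=
      isOpen_lt continuous_const (continuous_truncatedDistExtend A x₀ r)
    rw [mem_closure_iff]
    intro U hU hqU
    obtain ⟨x, hxU, hx⟩ := (denseRange_higsonIncl A x₀).exists_mem_open (hU.inter hopen)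
      ⟨q, hqU, hpos⟩
    refine ⟨_, hxU, x, ?_, rfl⟩
    rw [Set.mem_ofPred_eq, truncatedDistExtend_incl, lt_max_iff] at hx
    rw [Metric.mem_closedBall, dist_comm]
    have := hx.resolve_left (lt_irrefl 0)
    linarith
  · rintro h ⟨x, rfl⟩
    have := (le_max_right _ _).trans (h (dist x₀ x + 1))
    linarith

theorem isClosed_higsonCorona [ProperSpace X] (A : HigsonKind) (x₀ : X) :
    IsClosed (higsonCorona A x₀) := by
  have : higsonCorona A x₀ = ⋂ r, {q | truncatedDistExtend A x₀ r q ≤ 0} := by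
    ext q
    simp [mem_higsonCorona_iff]
  rw [this]
  exact isClosed_iInter fun r =>
    isClosed_le (continuous_truncatedDistExtend A x₀ r) continuous_const

/-- Canonical maps preserve the extended truncated distances, which detect the corona. -/
theorem IsCanonicalHigsonMap.mem_higsonCorona_iff [ProperSpace X] {A B : HigsonKind} {x₀ : X}
    {α : HigsonCompactification A x₀ → HigsonCompactification B x₀}
    (hα : IsCanonicalHigsonMap A B x₀ α) (q : HigsonCompactification A x₀) :
    α q ∈ higsonCorona B x₀ ↔ q ∈ higsonCorona A x₀ := by
  have h : ∀ r, truncatedDistExtend B x₀ r ∘ α = truncatedDistExtend A x₀ r := fun r =>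
    (denseRange_higsonIncl A x₀).equalizer ((continuous_truncatedDistExtend B x₀ r).comp hα.1)
      (continuous_truncatedDistExtend A x₀ r) <| funext fun x => by
        simp only [Function.comp_apply, hα.2 x, truncatedDistExtend_incl]
  simp only [_root_.mem_higsonCorona_iff, ← h, Function.comp_apply]

theorem IsCanonicalHigsonMap.image_higsonCorona [ProperSpace X] {A B : HigsonKind} {x₀ : X}
    {α : HigsonCompactification A x₀ → HigsonCompactification B x₀}
    (hα : IsCanonicalHigsonMap A B x₀ α) : α '' higsonCorona A x₀ = higsonCorona B x₀ := by
  rw [← hα.surjective.image_preimage (higsonCorona B x₀)]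
  congr 1
  ext q
  exact (hα.mem_higsonCorona_iff q).symm

/-- A continuous map whose fibres are all unbounded extends to a map whose restriction to the corona
is already surjective. -/
theorem higsonMap_image_higsonCorona_eq_univ [ProperSpace X] {A B : HigsonKind} {x₀ : X} {y₀ : Y}
    {g : C(X, Y)} (hg : ∀ f ∈ higsonFunctions B y₀, f.compContinuous g ∈ higsonFunctions A x₀)
    (hfib : ∀ y (R : ℝ), ∃ x, R ≤ dist x₀ x ∧ g x = y) :
    higsonMap A B x₀ y₀ g hg '' higsonCorona A x₀ = Set.univ := by
  refine (isClosed_higsonCorona A x₀).isCompact.image_eq_univ_of_higsonIncl_mem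
    (continuous_higsonMap hg) fun y => ?_
  choose x hxR hxy using fun n : ℕ => hfib y n
  obtain ⟨q, hq⟩ := exists_clusterPt_of_compactSpace (map (fun n => higsonIncl A x₀ (x n)) atTop)
  -- A closed set that eventually contains the sequence contains its cluster point `q`.
  have hcl : ∀ S : Set (HigsonCompactification A x₀), IsClosed S →
      (∀ᶠ n in atTop, higsonIncl A x₀ (x n) ∈ S) → q ∈ S := fun S hS h =>
    hS.closure_subset (mem_closure_iff_clusterPt.2 (hq.mono (le_principal_iff.2 h)))
  refine ⟨q, mem_higsonCorona_iff.2 fun r => ?_, ?_⟩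
  · refine hcl {p | truncatedDistExtend A x₀ r p ≤ 0}
      (isClosed_le (continuous_truncatedDistExtend A x₀ r) continuous_const) ?_
    filter_upwards [eventually_ge_atTop ⌈r⌉₊] with n hn
    have h1 : r ≤ dist x₀ (x n) := (Nat.ceil_le.1 hn).trans (hxR n)
    exact max_le le_rfl (by linarith)
  · refine hcl {p | higsonMap A B x₀ y₀ g hg p = higsonIncl B y₀ y}
      (isClosed_eq (continuous_higsonMap hg) continuous_const) (Eventually.of_forall fun n => ?_)
    rw [Set.mem_ofPred_eq, higsonMap_incl, hxy]

end Compactification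

/-! ### A slowly oscillating function on the half-line -/

/-- In the variable `u = exp v - 1`, the function `v sin v` has derivative
`(sin v + v cos v) / (1 + u)`, which is bounded by one because `1 + v ≤ exp v`. -/
theorem abs_log_mul_sin_log_sub_le {u w : ℝ} (hu : 0 ≤ u) (hw : 0 ≤ w) :
    |Real.log (1 + w) * Real.sin (Real.log (1 + w)) -
      Real.log (1 + u) * Real.sin (Real.log (1 + u))| ≤ |w - u| := by
  have key := (convex_Ici (0 : ℝ)).norm_image_sub_le_of_norm_hasDerivWithin_le
    (f := fun u => Real.log (1 + u) * Real.sin (Real.log (1 + u)))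
    (f' := fun u => 1 / (1 + u) * Real.sin (Real.log (1 + u)) +
      Real.log (1 + u) * (Real.cos (Real.log (1 + u)) * (1 / (1 + u)))) (C := 1) (x := u) (y := w)
    (fun t ht => ?_) (fun t ht => ?_) hu hw
  · simpa using key
  · have ht' : (1 : ℝ) + t ≠ 0 := (add_pos_of_pos_of_nonneg one_pos ht).ne'
    have hlog : HasDerivAt (fun u : ℝ => Real.log (1 + u)) (1 / (1 + t)) t :=
      ((hasDerivAt_id t).const_add 1).log ht'
    exact (hlog.mul hlog.sin).hasDerivWithinAt
  · have ht : (0 : ℝ) ≤ t := ht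
    have hpos : (0 : ℝ) < 1 + t := by linarith
    have hl0 : 0 ≤ Real.log (1 + t) := Real.log_nonneg (by linarith)
    have hl1 : Real.log (1 + t) ≤ t := by linarith [Real.log_le_sub_one_of_pos hpos]
    have hs := Real.abs_sin_le_one (Real.log (1 + t))
    have hc := Real.abs_cos_le_one (Real.log (1 + t))
    have hrw : 1 / (1 + t) * Real.sin (Real.log (1 + t)) +
        Real.log (1 + t) * (Real.cos (Real.log (1 + t)) * (1 / (1 + t))) =
        (Real.sin (Real.log (1 + t)) + Real.log (1 + t) * Real.cos (Real.log (1 + t))) /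
          (1 + t) := by
      field_simp
    rw [hrw, Real.norm_eq_abs, abs_div, abs_of_pos hpos, div_le_one hpos]
    refine (abs_add_le _ _).trans (add_le_add hs ?_)
    rw [abs_mul, abs_of_nonneg hl0]
    nlinarith

/-- The function `x ↦ |v sin v|` on `[0, ∞)`, where `v = log (1 + log (1 + x))`. The outer logarithm
compensates the growing slope of `v sin v`, the inner one makes the variation over balls of sublinear
radius vanish at infinity. -/
noncomputable def slowOscillation : C(NNReal, NNReal) where
  toFun x := ‖Real.log (1 + Real.log (1 + x)) * Real.sin (Real.log (1 + Real.log (1 + x)))‖₊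
  continuous_toFun := by
    have h1 : ∀ x : NNReal, (1 : ℝ) + x ≠ 0 := fun x => by positivity
    have h2 : ∀ x : NNReal, (1 : ℝ) + Real.log (1 + x) ≠ 0 := fun x => by
      have : 0 ≤ Real.log (1 + x) := Real.log_nonneg (by simp)
      positivity
    have h3 : Continuous fun x : NNReal => Real.log (1 + Real.log (1 + (x : ℝ))) :=
      (continuous_const.add ((continuous_const.add NNReal.continuous_coe).log h1)).log h2
    exact (h3.mul (Real.continuous_sin.comp h3)).nnnorm

theorem coe_slowOscillation (x : NNReal) :
    (slowOscillation x : ℝ) = |Real.log (1 + Real.log (1 + x)) *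
      Real.sin (Real.log (1 + Real.log (1 + x)))| := rfl

theorem dist_slowOscillation_le (x y : NNReal) :
    dist (slowOscillation y) (slowOscillation x) ≤ |Real.log (1 + y) - Real.log (1 + x)| := by
  rw [NNReal.dist_eq, coe_slowOscillation, coe_slowOscillation]
  exact (abs_abs_sub_abs_le _ _).trans (abs_log_mul_sin_log_sub_le
    (Real.log_nonneg (by simp)) (Real.log_nonneg (by simp)))

theorem abs_log_sub_log_le {a b m : ℝ} (hm : 0 < m) (ha : m ≤ a) (hb : m ≤ b) :
    |Real.log a - Real.log b| ≤ |a - b| / m := by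
  have key : ∀ {a b : ℝ}, m ≤ a → m ≤ b → Real.log a - Real.log b ≤ |a - b| / m := by
    intro a b ha hb
    have ha0 := hm.trans_le ha
    have hb0 := hm.trans_le hb
    rw [← Real.log_div ha0.ne' hb0.ne']
    calc Real.log (a / b) ≤ a / b - 1 := Real.log_le_sub_one_of_pos (div_pos ha0 hb0)
      _ = (a - b) / b := by field_simp
      _ ≤ |a - b| / b := by gcongr; exact le_abs_self _
      _ ≤ |a - b| / m := by gcongr
  rw [abs_le]
  have := key hb ha
  rw [abs_sub_comm] at this
  exact ⟨by linarith, key ha hb⟩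

theorem vanishingVariation_slowOscillation {s : ℝ → ℝ} (hs : IsAsymptoticallySublinear s) :
    VanishingVariation (0 : NNReal) s slowOscillation := by
  rw [VanishingVariation, ENNReal.tendsto_nhds_zero]
  intro ε hε
  obtain ⟨δ, hδ0, hδ⟩ : ∃ δ : ℝ, 0 < δ ∧ ENNReal.ofReal δ ≤ ε := by
    obtain ⟨δ, hδ0, hδ⟩ := ENNReal.lt_iff_exists_nnreal_btwn.1 hε
    exact ⟨δ, by exact_mod_cast hδ0, by simpa using hδ.le⟩
  -- If `|y - x| < c x` with `c ≤ 1 / 2`, then `|log (1 + y) - log (1 + x)| ≤ 2 c`,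
  -- so two such points `y` have images at distance at most `4 c ≤ δ`.
  set c : ℝ := min (1 / 2) (δ / 4) with hc
  have hc0 : 0 < c := by positivity
  have hc1 : c ≤ 1 / 2 := min_le_left _ _
  have hc2 : c ≤ δ / 4 := min_le_right _ _
  filter_upwards [hs.eventually_lt_mul_dist (0 : NNReal) hc0] with x hx
  have hdist : dist (0 : NNReal) x = x := by simp [NNReal.dist_eq]
  rw [hdist] at hx ⊢
  have hx0 : (0 : ℝ) ≤ x := x.2
  have hball : ∀ y ∈ Metric.ball x (s x),
      dist (slowOscillation y) (slowOscillation x) ≤ δ / 2 := by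
    intro y hy
    rw [Metric.mem_ball, NNReal.dist_eq] at hy
    have hyx : |(y : ℝ) - x| ≤ c * x := (hy.trans hx).le
    have hcx : c * x ≤ 1 / 2 * x := mul_le_mul_of_nonneg_right hc1 hx0
    have hy1 := (abs_le.1 (hyx.trans hcx)).1
    refine (dist_slowOscillation_le x y).trans ?_
    refine (abs_log_sub_log_le (m := 1 + x / 2) (by positivity) (by linarith)
      (by linarith)).trans ?_
    rw [div_le_iff₀ (by positivity), add_sub_add_left_eq_sub]
    have : c * x ≤ δ / 4 * x := mul_le_mul_of_nonneg_right hc2 hx0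
    nlinarith
  refine (Metric.ediam_le ?_).trans hδ
  rintro _ ⟨a, ha, rfl⟩ _ ⟨b, hb, rfl⟩
  rw [edist_dist]
  refine ENNReal.ofReal_le_ofReal ((dist_triangle_right _ _ (slowOscillation x)).trans ?_)
  linarith [hball a ha, hball b hb]

theorem compContinuous_slowOscillation_mem_higsonFunctions (A : HigsonKind)
    (f : BoundedContinuousFunction NNReal ℝ)
    (hf : f ∈ higsonFunctions HigsonKind.H (0 : NNReal)) :
    f.compContinuous slowOscillation ∈ higsonFunctions A (0 : NNReal) := fun _ hs =>
  (vanishingVariation_slowOscillation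
    (HigsonKind.isAsymptoticallySublinear_of_mem_scales hs)).comp_uniformContinuous
      (uniformContinuous_of_mem_higsonFunctions_H hf)

/-- Between `2πn` and `2πn + π/2` the function `|v sin v|` increases from `0` to at least `n`. -/
theorem exists_slowOscillation_eq (y : NNReal) (R : ℝ) :
    ∃ x : NNReal, R ≤ dist 0 x ∧ slowOscillation x = y := by
  obtain ⟨n, hn⟩ := exists_nat_ge (max R y)
  have hRn : R ≤ n := (le_max_left _ _).trans hn
  have hyn : (y : ℝ) ≤ n := (le_max_right _ _).trans hn
  have hn0 : (0 : ℝ) ≤ n := n.cast_nonneg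
  have hpi := Real.pi_gt_three
  have hnpi : (n : ℝ) ≤ n * (2 * Real.pi) := by nlinarith
  have hivt := intermediate_value_Icc
    (f := fun v : ℝ => |v * Real.sin v|) (a := n * (2 * Real.pi))
    (b := Real.pi / 2 + n * (2 * Real.pi)) (by linarith) (by fun_prop)
  simp only [Real.sin_add_nat_mul_two_pi, Real.sin_pi_div_two] at hivt
  have h0 : Real.sin (n * (2 * Real.pi)) = 0 := by
    simpa using Real.sin_add_nat_mul_two_pi 0 n
  rw [h0, mul_zero, abs_zero, mul_one, abs_of_nonneg (by linarith)] at hivt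
  obtain ⟨v, ⟨hv, -⟩, hvy⟩ := hivt (show (y : ℝ) ∈ Set.Icc _ _ from ⟨y.2, by linarith⟩)
  have hnv : (n : ℝ) ≤ v := hnpi.trans hv
  have hu := Real.add_one_le_exp v
  have hx := Real.add_one_le_exp (Real.exp v - 1)
  obtain ⟨x, hxv⟩ : ∃ x : NNReal, (x : ℝ) = Real.exp (Real.exp v - 1) - 1 :=
    ⟨⟨_, by linarith⟩, rfl⟩
  refine ⟨x, ?_, ?_⟩
  · rw [NNReal.dist_eq, NNReal.coe_zero, zero_sub, abs_neg]
    exact le_trans (by linarith) (le_abs_self _)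
  · rw [← NNReal.coe_inj, coe_slowOscillation, hxv, add_sub_cancel, Real.log_exp,
      add_sub_cancel, Real.log_exp]
    exact hvy

theorem exists_continuous_surjective_higsonCorona (A B : HigsonKind) :
    ∃ ξ : higsonCorona A (0 : NNReal) → HigsonCompactification B (0 : NNReal),
      Continuous ξ ∧ Function.Surjective ξ := by
  obtain ⟨γ, hγ⟩ := exists_isCanonicalHigsonMap_H B (0 : NNReal)
  have hg := compContinuous_slowOscillation_mem_higsonFunctions A
  refine ⟨γ ∘ (higsonCorona A (0 : NNReal)).domRestrict (higsonMap A HigsonKind.H 0 0 _ hg),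
    hγ.1.comp ((continuous_higsonMap hg).comp continuous_subtype_val), hγ.surjective.comp ?_⟩
  rw [← Set.range_eq_univ, Set.range_domRestrict]
  exact higsonMap_image_higsonCorona_eq_univ hg exists_slowOscillation_eq

/-! ### Surjections from the Higson corona of the half-line -/

theorem corollary3p7 :
    ∃ α : HigsonCompactification HigsonKind.H (0 : NNReal) →
        HigsonCompactification HigsonKind.P (0 : NNReal),
      IsCanonicalHigsonMap HigsonKind.H HigsonKind.P (0 : NNReal) α ∧
      (∀ β, IsCanonicalHigsonMap HigsonKind.H HigsonKind.P (0 : NNReal) β → β = α) ∧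
      α '' higsonCorona HigsonKind.H (0 : NNReal) = higsonCorona HigsonKind.P (0 : NNReal) ∧
      ∀ A : HigsonKind,
        ∃ (η : higsonCorona HigsonKind.H (0 : NNReal) → HigsonCompactification A (0 : NNReal))
          (ξ : higsonCorona HigsonKind.P (0 : NNReal) → HigsonCompactification A (0 : NNReal)),
          (Continuous η ∧ Function.Surjective η) ∧
          (Continuous ξ ∧ Function.Surjective ξ) ∧
          ∀ (p : higsonCorona HigsonKind.H (0 : NNReal))
            (q : higsonCorona HigsonKind.P (0 : NNReal)),
            α (p : HigsonCompactification HigsonKind.H (0 : NNReal)) = q → η p = ξ q := by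
  obtain ⟨α, hα⟩ := exists_isCanonicalHigsonMap_H HigsonKind.P (0 : NNReal)
  refine ⟨α, hα, fun β hβ => hβ.unique hα, hα.image_higsonCorona, fun A => ?_⟩
  obtain ⟨ξ, hξc, hξs⟩ := exists_continuous_surjective_higsonCorona HigsonKind.P A
  refine ⟨fun p => ξ ⟨α p, (hα.mem_higsonCorona_iff p).2 p.2⟩, ξ,
    ⟨hξc.comp ((hα.1.comp continuous_subtype_val).subtype_mk _), fun z => ?_⟩,
    ⟨hξc, hξs⟩, fun p q hpq => congrArg ξ (Subtype.ext hpq)⟩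
  obtain ⟨q, rfl⟩ := hξs z
  obtain ⟨p, hp, hpq⟩ := hα.image_higsonCorona.ge q.2
  exact ⟨⟨p, hp⟩, congrArg ξ (Subtype.ext hpq)⟩
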